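/- Let $G=(V,E)$ be a finite, simple, connected graph with $|E|\ge 2$, and let $B\subseteq V$ (possibly empty) be such that $V^\circ:=V\setminus B$ is nonempty and induces a connected subgraph. Fix a boundary condition $\eta\in\{-1,1\}^B$ ($B=\emptyset$ is the free boundary condition). Let $J=(J_e)_{e\in E}$ be i.i.d. standard Gaussian random variables, and let $H_J(\sigma)=-\sum_{\{i,j\}\in E}J_{ij}\sigma_i\sigma_j$ for $\sigma\in\{-1,1\}^V$. For an edge $e=\{i,j\}$, let $\sigma^1$ (respectively $\sigma^2$) be a minimizer of $H_J$ over the configurations that agree with $\eta$ on $B$ and satisfy $\sigma_i=\sigma_j$ (respectively $\sigma_i=-\sigma_j$). The critical droplet $D(e)$ is the set of sites where $\sigma^1$ and $\sigma^2$ disagree; almost surely it is unique if $B\neq\emptyset$, and unique up to complementation if $B=\emptyset$. If $B=\emptyset$, the size $|D(e)|$ is understood as the minimum of the sizes of this set and of its complement in $V$. If both ends of $e$ lie in $B$, so that one of the two constraints cannot be satisfied, then $D(e):=\emptyset$. Let $d$ be the graph distance on $G$, and let $\alpha,\beta,\gamma,\delta>0$ be such that for every $i\in V^\circ$ and every real $r\ge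 1$, $$|\{j\in V: d(i,j)\le r\}|\le \alpha r^\beta \quad\text{and}\quad |\{j\in V: \min_{k\in B} d(j,k)\le r\}|\le \gamma |B| r^\delta,$$ where the minimum over an empty set is $+\infty$. Then each $|D(e)|$ is integrable, and $$\frac{1}{|E|}\sum_{e\in E}\mathbb{E}|D(e)|\ \ge\ \frac{C\,|V^\circ|}{|E|\,\max\bigl\{|V^\circ|^{-1/\beta},\ (|B|/|V^\circ|)^{1/\delta}\bigr\}},$$ where $C>0$ is a constant depending only on $\alpha,\beta,\gamma,\delta$. -/

import Mathlib

open MeasureTheory ProbabilityTheory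

universe u

noncomputable section

namespace EdwardsAnderson

/-- The product `σ i * σ j` of the two spins at the ends of the pair `{i, j}`. Spins take values
in `ℤˣ = {1, -1}`. -/
def bond {V : Type u} (σ : V → ℤˣ) (e : Sym2 V) : ℤˣ :=
  Sym2.lift ⟨fun i j => σ i * σ j, fun i j => mul_comm (σ i) (σ j)⟩ e

theorem bond_eq_one_iff {W : Type u} (σ : W → ℤˣ) (i j : W) :
    bond σ s(i, j) = 1 ↔ σ i = σ j := by
  change σ i * σ j = 1 ↔ σ i = σ j
  rcases Int.units_eq_one_or (σ i) with h | h <;> rcases Int.units_eq_one_or (σ j) with h' | h' <;>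
    simp [h, h']

theorem bond_eq_neg_one_iff {W : Type u} (σ : W → ℤˣ) (i j : W) :
    bond σ s(i, j) = -1 ↔ σ i = -σ j := by
  change σ i * σ j = -1 ↔ σ i = -σ j
  rcases Int.units_eq_one_or (σ i) with h | h <;> rcases Int.units_eq_one_or (σ j) with h' | h' <;>
    simp [h, h']

variable {V : Type u} [Fintype V] [DecidableEq V] (G : SimpleGraph V) [DecidableRel G.Adj]

/-- The Hamiltonian `H_J(σ) = -∑_{{i,j} ∈ E} J_{ij} σ_i σ_j`. -/
def hamiltonian (J : G.edgeSet → ℝ) (σ : V → ℤˣ) : ℝ :=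
  -∑ e : G.edgeSet, J e * (((bond σ (e : Sym2 V) : ℤˣ) : ℤ) : ℝ)

/-- The law of the disorder: independent standard Gaussian weights on the edges. -/
def disorder : Measure (G.edgeSet → ℝ) :=
  Measure.pi fun _ : G.edgeSet => gaussianReal 0 1

/-- The configurations that agree with `bc` on `B` (all configurations if `B = ∅`, which is the
free boundary condition) and whose spins at the two ends of `e` have product `s`: for `s = 1` the
spins are constrained to be equal, for `s = -1` to be opposite. -/
def feasible (B : Finset V) (bc : B → ℤˣ) (e : G.edgeSet) (s : ℤˣ) : Set (V → ℤˣ) :=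
  {σ | (∀ i : B, σ i = bc i) ∧ bond σ (e : Sym2 V) = s}

/-- `σ` minimizes the energy among the feasible configurations. -/
def IsConstrainedMin (B : Finset V) (bc : B → ℤˣ) (J : G.edgeSet → ℝ) (e : G.edgeSet) (s : ℤˣ)
    (σ : V → ℤˣ) : Prop :=
  σ ∈ feasible G B bc e s ∧ ∀ τ ∈ feasible G B bc e s, hamiltonian G J σ ≤ hamiltonian G J τ

/-- `A` is a critical droplet of the edge `e`: the set of sites at which a minimizer with equal
spins across `e` and a minimizer with opposite spins across `e` disagree. -/
def IsCriticalDroplet (B : Finset V) (bc : B → ℤˣ) (J : G.edgeSet → ℝ) (e : G.edgeSet)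
    (A : Finset V) : Prop :=
  ∃ σ₁ σ₂ : V → ℤˣ, IsConstrainedMin G B bc J e 1 σ₁ ∧ IsConstrainedMin G B bc J e (-1) σ₂ ∧
    A = Finset.univ.filter fun i => σ₁ i ≠ σ₂ i

/-- The size attached to a droplet `A`: `|A|` under a boundary condition, and
`min (|A|, |V \ A|)` under the free boundary condition. -/
def regionSize (B A : Finset V) : ℕ :=
  if B = ∅ then min A.card Aᶜ.card else A.card

/-- The size of the critical droplet of `e`. For almost every `J` all critical droplets of `e` have
the same `regionSize`; on the exceptional null set the smallest value is taken. If both ends of `e`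
lie in `B`, one of the two constraints cannot be met, there is no droplet, and the size is `0`. -/
def dropletSize (B : Finset V) (bc : B → ℤˣ) (J : G.edgeSet → ℝ) (e : G.edgeSet) : ℕ :=
  sInf {n | ∃ A : Finset V, IsCriticalDroplet G B bc J e A ∧ n = regionSize B A}

end EdwardsAnderson

end

set_option linter.unusedSectionVars false

namespace EdwardsAnderson

variable {V : Type u}

/-! Let `U` be a ball around `i` avoiding `j` and `B`. Reversing the couplings on the cut of `U`
amounts to flipping the spins in `U`, so it flips the ground state product `σ i * σ j`. Reverse the
cut edges one at a time: each intermediate disorder has the same law, and if the product changes at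
edge `e`, the critical droplet of `e` separates `i` from `j` (`separates_of_mul_ne`). So the
separation probabilities over the cut sum to at least 1. Cuts of concentric balls are disjoint, so
over all edges the sum is at least the number of admissible radii (`le_sum_separates`). Summing over
`i` with `j` fixed in `B`, or over all pairs if `B = ∅`, turns separation into droplet size. The
growth bounds force most distances to be large. -/

theorem bond_mul (σ τ : V → ℤˣ) (e : Sym2 V) : bond (σ * τ) e = bond σ e * bond τ e := by
  induction e with
  | _ i j => exact mul_mul_mul_comm (σ i) (τ i) (σ j) (τ j)

/-- Bond products telescope along a walk, since squared spins are 1. -/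
theorem mul_eq_mul_of_walk {G : SimpleGraph V} {σ τ : V → ℤˣ}
    (h : ∀ e : G.edgeSet, bond σ (e : Sym2 V) = bond τ (e : Sym2 V)) {i j : V} (w : G.Walk i j) :
    σ i * σ j = τ i * τ j := by
  induction w with
  | nil => simp
  | @cons a b c hab w ih =>
    have hb : σ a * σ b = τ a * τ b := h ⟨s(a, b), hab⟩
    calc σ a * σ c = (σ a * σ b) * (σ b * σ c) := by
          rw [mul_assoc, ← mul_assoc (σ b), Int.units_mul_self, one_mul]
      _ = (τ a * τ b) * (τ b * τ c) := by rw [hb, ih]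
      _ = τ a * τ c := by
          rw [mul_assoc, ← mul_assoc (τ b), Int.units_mul_self, one_mul]

variable [Fintype V] [DecidableEq V] (G : SimpleGraph V) [DecidableRel G.Adj]

/-! ### Sign reversals and generic disorder -/

/-- Reverse the sign of the couplings on `S`. -/
def reverseOn (S : Finset G.edgeSet) (J : G.edgeSet → ℝ) : G.edgeSet → ℝ :=
  fun e => if e ∈ S then -J e else J e

theorem reverseOn_empty (J : G.edgeSet → ℝ) : reverseOn G ∅ J = J := by
  funext e; simp [reverseOn]

theorem reverseOn_insert {S : Finset G.edgeSet} {e : G.edgeSet} (he : e ∉ S) (J : G.edgeSet → ℝ) :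
    reverseOn G (insert e S) J = reverseOn G {e} (reverseOn G S J) := by
  funext e'
  by_cases h : e' = e
  · subst h; simp [reverseOn, he]
  · simp [reverseOn, h]

theorem measurePreserving_reverseOn (S : Finset G.edgeSet) :
    MeasurePreserving (reverseOn G S) (disorder G) (disorder G) := by
  have key : ∀ e : G.edgeSet, MeasurePreserving (fun x : ℝ => if e ∈ S then -x else x)
      (gaussianReal 0 1) (gaussianReal 0 1) := by
    intro e
    by_cases h : e ∈ S
    · simp only [h, if_true]
      exact ⟨measurable_neg, by simpa using gaussianReal_map_neg (μ := 0) (v := 1)⟩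
    · simp only [h, if_false]
      exact MeasurePreserving.id _
  exact measurePreserving_pi _ _ key

instance : IsProbabilityMeasure (disorder G) := by
  unfold disorder; infer_instance

theorem measurable_hamiltonian (σ : V → ℤˣ) : Measurable fun J => hamiltonian G J σ := by
  unfold hamiltonian; fun_prop

/-- Configurations of equal energy have the same bond variables. -/
def Generic (J : G.edgeSet → ℝ) : Prop :=
  ∀ σ τ : V → ℤˣ, hamiltonian G J σ = hamiltonian G J τ →
    ∀ e : G.edgeSet, bond σ (e : Sym2 V) = bond τ (e : Sym2 V)

/-- The `i₀` term has no atoms and is independent of the other terms, so by Fubini it almost surely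
does not cancel their sum. -/
theorem ae_linear_ne_zero {ι : Type*} [Fintype ι] [DecidableEq ι] (μ : ι → Measure ℝ)
    [∀ i, IsProbabilityMeasure (μ i)] [∀ i, NullSingletonClass (μ i)] (c : ι → ℝ) {i₀ : ι}
    (h : c i₀ ≠ 0) : ∀ᵐ x ∂(Measure.pi μ), ∑ i, c i * x i ≠ 0 := by
  have hind : iIndepFun (fun i (x : ι → ℝ) => c i * x i) (Measure.pi μ) :=
    iIndepFun_pi (X := fun i (x : ℝ) => c i * x) (fun i => (measurable_const_mul (c i)).aemeasurable)
  set Y : (ι → ℝ) → ℝ := ∑ i ∈ Finset.univ.erase i₀, fun x => c i * x i with hY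
  have hYm : Measurable Y := by rw [hY]; fun_prop
  have hm : ∀ i, Measurable fun x : ι → ℝ => c i * x i := fun i =>
    (measurable_const_mul (c i)).comp (measurable_pi_apply i)
  have hi := hind.indepFun_finsetSum_of_notMem₀ (s := Finset.univ.erase i₀) (i := i₀)
    (fun i => (hm i).aemeasurable) (by simp)
  have hmap := (indepFun_iff_map_prod_eq_prod_map_map hYm.aemeasurable (hm i₀).aemeasurable).1 hi
  have hX : NullSingletonClass ((Measure.pi μ).map fun x => c i₀ * x i₀) := by
    refine ⟨fun y => ?_⟩
    rw [Measure.map_apply (by fun_prop) (measurableSet_singleton _)]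
    have : (fun x : ι → ℝ => c i₀ * x i₀) ⁻¹' {y} = Function.eval i₀ ⁻¹' ({y / c i₀} : Set ℝ) := by
      ext x
      simp only [Set.mem_preimage, Set.mem_singleton_iff, Function.eval]
      rw [eq_div_iff h, mul_comm]
    rw [this, (measurePreserving_eval μ i₀).measure_preimage
      (measurableSet_singleton _).nullMeasurableSet, measure_singleton]
  have hnull : ((Measure.pi μ).map (fun x => (Y x, c i₀ * x i₀))) {p | p.1 + p.2 = 0} = 0 := by
    rw [hmap, Measure.measure_prod_null
      (measurableSet_eq_fun (by fun_prop) (by fun_prop))]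
    filter_upwards with y
    have : Prod.mk y ⁻¹' {p : ℝ × ℝ | p.1 + p.2 = 0} = {-y} := by
      ext z
      simp only [Set.mem_preimage, Set.mem_ofPred_eq, Set.mem_singleton_iff]
      constructor <;> intro h <;> linarith
    rw [this, measure_singleton]; rfl
  rw [Measure.map_apply (by fun_prop) (measurableSet_eq_fun (by fun_prop) (by fun_prop))] at hnull
  rw [ae_iff]
  convert hnull using 2
  ext x
  simp only [ne_eq, not_not, Set.mem_ofPred_eq, Set.mem_preimage, hY, Finset.sum_apply]
  rw [Finset.sum_erase_add _ _ (Finset.mem_univ i₀)]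

theorem ae_generic : ∀ᵐ J ∂(disorder G), Generic G J := by
  unfold Generic
  refine ae_all_iff.2 fun σ => ae_all_iff.2 fun τ => ?_
  by_cases h : ∀ e : G.edgeSet, bond σ (e : Sym2 V) = bond τ (e : Sym2 V)
  · exact Filter.Eventually.of_forall fun _ _ => h
  push Not at h
  obtain ⟨e₀, h₀⟩ := h
  have hc : ((bond σ (e₀ : Sym2 V) : ℤ) : ℝ) - ((bond τ (e₀ : Sym2 V) : ℤ) : ℝ) ≠ 0 := by
    rw [sub_ne_zero]
    exact_mod_cast h₀
  have : NullSingletonClass (gaussianReal 0 1) := nullSingletonClass_gaussianReal one_ne_zero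
  filter_upwards [ae_linear_ne_zero (fun _ : G.edgeSet => gaussianReal 0 1)
    (fun e => ((bond σ (e : Sym2 V) : ℤ) : ℝ) - ((bond τ (e : Sym2 V) : ℤ) : ℝ)) hc] with J hJ hH
  refine absurd ?_ hJ
  simp only [hamiltonian, neg_inj] at hH
  simp only [sub_mul, Finset.sum_sub_distrib, sub_eq_zero]
  simpa only [mul_comm] using hH

theorem ae_generic_reverseOn : ∀ᵐ J ∂(disorder G), ∀ S, Generic G (reverseOn G S J) :=
  ae_all_iff.2 fun S =>
    (measurePreserving_reverseOn G S).quasiMeasurePreserving.ae (ae_generic G)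

/-! ### Ground states and critical droplets -/

/-- `σ` minimizes the energy among the configurations that agree with `bc` on `B`. -/
def IsGroundState (B : Finset V) (bc : B → ℤˣ) (J : G.edgeSet → ℝ) (σ : V → ℤˣ) : Prop :=
  (∀ i : B, σ i = bc i) ∧
    ∀ τ : V → ℤˣ, (∀ i : B, τ i = bc i) → hamiltonian G J σ ≤ hamiltonian G J τ

variable {G} {B : Finset V} {bc : B → ℤˣ} {J : G.edgeSet → ℝ}

theorem exists_isGroundState (B : Finset V) (bc : B → ℤˣ) (J : G.edgeSet → ℝ) :
    ∃ σ, IsGroundState G B bc J σ := by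
  have hne : {σ : V → ℤˣ | ∀ i : B, σ i = bc i}.Nonempty :=
    ⟨fun v => if h : v ∈ B then bc ⟨v, h⟩ else 1, fun i => by simp⟩
  obtain ⟨σ, hσ, hmin⟩ := Set.exists_min_image _ (hamiltonian G J) (Set.toFinite _) hne
  exact ⟨σ, hσ, hmin⟩

theorem IsGroundState.isConstrainedMin {σ : V → ℤˣ} (h : IsGroundState G B bc J σ)
    (e : G.edgeSet) : IsConstrainedMin G B bc J e (bond σ (e : Sym2 V)) σ :=
  ⟨⟨h.1, rfl⟩, fun τ hτ => h.2 τ hτ.1⟩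

theorem IsConstrainedMin.hamiltonian_eq {e : G.edgeSet} {s : ℤˣ} {σ τ : V → ℤˣ}
    (hσ : IsConstrainedMin G B bc J e s σ) (hτ : IsConstrainedMin G B bc J e s τ) :
    hamiltonian G J σ = hamiltonian G J τ :=
  le_antisymm (hσ.2 τ hτ.1) (hτ.2 σ hσ.1)

theorem hamiltonian_reverseOn_singleton (e : G.edgeSet) (σ : V → ℤˣ) :
    hamiltonian G (reverseOn G {e} J) σ =
      hamiltonian G J σ + 2 * J e * ((bond σ (e : Sym2 V) : ℤ) : ℝ) := by
  have h : ∀ e' : G.edgeSet, reverseOn G {e} J e' * ((bond σ (e' : Sym2 V) : ℤ) : ℝ) =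
      J e' * ((bond σ (e' : Sym2 V) : ℤ) : ℝ) -
        if e' = e then 2 * J e * ((bond σ (e : Sym2 V) : ℤ) : ℝ) else 0 := by
    intro e'
    by_cases he : e' = e
    · subst he; simp [reverseOn]; ring
    · simp [reverseOn, he]
  simp only [hamiltonian, h, Finset.sum_sub_distrib, Finset.sum_ite_eq', Finset.mem_univ, if_true]
  ring

/-- With the bond at `e` fixed, reversing `J e` shifts all feasible energies by the same constant.
-/
theorem IsConstrainedMin.of_reverseOn {e : G.edgeSet} {s : ℤˣ} {σ : V → ℤˣ}
    (h : IsConstrainedMin G B bc (reverseOn G {e} J) e s σ) : IsConstrainedMin G B bc J e s σ := by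
  refine ⟨h.1, fun τ hτ => ?_⟩
  have := h.2 τ hτ
  rw [hamiltonian_reverseOn_singleton, hamiltonian_reverseOn_singleton, h.1.2, hτ.2] at this
  linarith

theorem Generic.mul_eq_mul (hG : G.Connected) (hJ : Generic G J) {σ τ : V → ℤˣ}
    (h : hamiltonian G J σ = hamiltonian G J τ) (i j : V) : σ i * σ j = τ i * τ j :=
  mul_eq_mul_of_walk (hJ σ τ h) (hG i j).some

theorem ne_iff_of_mul_ne {a b c d : ℤˣ} (h : a * b ≠ c * d) : ¬(a ≠ c ↔ b ≠ d) := by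
  revert a b c d; decide

variable (G) in
/-- The edge `e` has a critical droplet, and every critical droplet of `e` contains exactly one of
the sites `i` and `j`. -/
def Separates (B : Finset V) (bc : B → ℤˣ) (J : G.edgeSet → ℝ) (e : G.edgeSet) (i j : V) : Prop :=
  (∃ A, IsCriticalDroplet G B bc J e A) ∧
    ∀ A, IsCriticalDroplet G B bc J e A → ¬(i ∈ A ↔ j ∈ A)

/-- Both states are constrained minimizers for the same `J`. Genericity forces them to have opposite
bonds at `e`, so they define a droplet, and it carries the conclusion over to every other droplet of
`e`. -/
theorem separates_of_mul_ne (hG : G.Connected) (hJ : Generic G J) {e : G.edgeSet} {σ τ : V → ℤˣ}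
    (hσ : IsGroundState G B bc J σ) (hτ : IsGroundState G B bc (reverseOn G {e} J) τ) {i j : V}
    (hne : σ i * σ j ≠ τ i * τ j) : Separates G B bc J e i j := by
  have h1 := hσ.isConstrainedMin e
  have h2 := (hτ.isConstrainedMin e).of_reverseOn
  have hb : bond σ (e : Sym2 V) ≠ bond τ (e : Sym2 V) := fun hb =>
    hne (hJ.mul_eq_mul hG (h1.hamiltonian_eq (hb ▸ h2)) i j)
  obtain ⟨σ₁, σ₂, m1, m2, hne'⟩ : ∃ σ₁ σ₂ : V → ℤˣ, IsConstrainedMin G B bc J e 1 σ₁ ∧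
      IsConstrainedMin G B bc J e (-1) σ₂ ∧ σ₁ i * σ₁ j ≠ σ₂ i * σ₂ j := by
    rcases Int.units_eq_one_or (bond σ (e : Sym2 V)) with hs | hs <;>
      rcases Int.units_eq_one_or (bond τ (e : Sym2 V)) with ht | ht <;>
      rw [hs] at h1 <;> rw [ht] at h2
    · exact absurd (hs.trans ht.symm) hb
    · exact ⟨σ, τ, h1, h2, hne⟩
    · exact ⟨τ, σ, h2, h1, hne.symm⟩
    · exact absurd (hs.trans ht.symm) hb
  refine ⟨⟨_, σ₁, σ₂, m1, m2, rfl⟩, ?_⟩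
  rintro A ⟨τ₁, τ₂, n1, n2, rfl⟩
  rw [hJ.mul_eq_mul hG (m1.hamiltonian_eq n1), hJ.mul_eq_mul hG (m2.hamiltonian_eq n2)] at hne'
  simpa using ne_iff_of_mul_ne hne'

/-! ### Measurability, and droplet size as a count of separated sites -/

theorem measurable_isCriticalDroplet (B : Finset V) (bc : B → ℤˣ) (e : G.edgeSet)
    (A : Finset V) : Measurable fun J => IsCriticalDroplet G B bc J e A := by
  have h : ∀ s σ, Measurable fun J => IsConstrainedMin G B bc J e s σ := fun s σ =>
    measurable_const.and <| Measurable.forall fun τ => Measurable.forall fun _ =>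
      measurableSet_setOfPred.1
        (measurableSet_le (measurable_hamiltonian G σ) (measurable_hamiltonian G τ))
  exact Measurable.exists fun σ₁ => Measurable.exists fun σ₂ =>
    (h 1 σ₁).and ((h (-1) σ₂).and measurable_const)

theorem measurableSet_separates (B : Finset V) (bc : B → ℤˣ) (e : G.edgeSet) (i j : V) :
    MeasurableSet {J | Separates G B bc J e i j} :=
  measurableSet_setOfPred.2 <| (Measurable.exists fun A => measurable_isCriticalDroplet B bc e A).and <|
    Measurable.forall fun A => (measurable_isCriticalDroplet B bc e A).imp measurable_const

theorem measurable_dropletSize (B : Finset V) (bc : B → ℤˣ) (e : G.edgeSet) :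
    Measurable fun J => dropletSize G B bc J e := by
  have h : Measurable fun J => fun A => IsCriticalDroplet G B bc J e A :=
    measurable_pi_lambda _ fun A => measurable_isCriticalDroplet B bc e A
  -- The size depends on `J` only through a predicate on the finite type `Finset V`.
  exact (Measurable.of_discrete
    (f := fun p : Finset V → Prop => sInf {n | ∃ A, p A ∧ n = regionSize B A})).comp h

theorem regionSize_le_card (B A : Finset V) : regionSize B A ≤ Fintype.card V := by
  unfold regionSize
  split_ifs
  · exact (min_le_left _ _).trans A.card_le_univ
  · exact A.card_le_univ

theorem exists_dropletSize_eq {e : G.edgeSet} (h : ∃ A, IsCriticalDroplet G B bc J e A) :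
    ∃ A, IsCriticalDroplet G B bc J e A ∧ dropletSize G B bc J e = regionSize B A :=
  have ⟨A, hA⟩ := h
  Nat.sInf_mem (s := {n | ∃ A, IsCriticalDroplet G B bc J e A ∧ n = regionSize B A}) ⟨_, A, hA, rfl⟩

theorem dropletSize_le_card (B : Finset V) (bc : B → ℤˣ) (J : G.edgeSet → ℝ) (e : G.edgeSet) :
    dropletSize G B bc J e ≤ Fintype.card V := by
  by_cases h : ∃ A, IsCriticalDroplet G B bc J e A
  · obtain ⟨A, -, hA⟩ := exists_dropletSize_eq h
    exact hA ▸ regionSize_le_card B A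
  · push Not at h
    simp [dropletSize, h]

theorem integrable_dropletSize (B : Finset V) (bc : B → ℤˣ) (e : G.edgeSet) :
    Integrable (fun J => (dropletSize G B bc J e : ℝ)) (disorder G) := by
  refine Integrable.of_bound (C := Fintype.card V)
    (measurable_from_nat.comp (measurable_dropletSize B bc e)).aestronglyMeasurable
    (Filter.Eventually.of_forall fun J => ?_)
  simpa using dropletSize_le_card B bc J e

open Classical in
-- Both minimizers equal `bc` at `k`, so `k` lies outside every droplet and the separated sites lie
-- inside.
theorem card_separates_le_of_mem {k : V} (hk : k ∈ B) (e : G.edgeSet) :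
    (Finset.univ.filter fun i => Separates G B bc J e i k).card ≤ dropletSize G B bc J e := by
  by_cases h : ∃ A, IsCriticalDroplet G B bc J e A
  · obtain ⟨A, hA, hs⟩ := exists_dropletSize_eq h
    have hkA : k ∉ A := by
      obtain ⟨σ₁, σ₂, h1, h2, rfl⟩ := hA
      simp [h1.1.1 ⟨k, hk⟩, h2.1.1 ⟨k, hk⟩]
    rw [hs, regionSize, if_neg (Finset.ne_empty_of_mem hk)]
    refine Finset.card_le_card fun i hi => ?_
    simpa [hkA] using (Finset.mem_filter.1 hi).2.2 A hA
  · simp [Separates, h]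

open Classical in
-- A droplet `A` separates `2 * |A| * |Aᶜ|` ordered pairs, and the larger factor is at most `|V|`.
theorem card_separates_le_of_empty (hB : B = ∅) (e : G.edgeSet) :
    (Finset.univ.filter fun p : V × V => Separates G B bc J e p.1 p.2).card ≤
      2 * Fintype.card V * dropletSize G B bc J e := by
  by_cases h : ∃ A, IsCriticalDroplet G B bc J e A
  · obtain ⟨A, hA, hs⟩ := exists_dropletSize_eq h
    rw [hs, regionSize, if_pos hB]
    have hsub : (Finset.univ.filter fun p : V × V => Separates G B bc J e p.1 p.2) ⊆
        A ×ˢ Aᶜ ∪ Aᶜ ×ˢ A := by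
      rintro ⟨i, j⟩ hp
      have := (Finset.mem_filter.1 hp).2.2 A hA
      simp only [Finset.mem_union, Finset.mem_product, Finset.mem_compl]
      tauto
    have hle : A.card * Aᶜ.card ≤ Fintype.card V * min A.card Aᶜ.card := by
      rcases le_total A.card Aᶜ.card with hle | hle
      · rw [min_eq_left hle, mul_comm]
        exact Nat.mul_le_mul_right _ Aᶜ.card_le_univ
      · rw [min_eq_right hle]
        exact Nat.mul_le_mul_right _ A.card_le_univ
    calc _ ≤ _ := Finset.card_le_card hsub
      _ ≤ _ := Finset.card_union_le _ _
      _ ≤ _ := by simp only [Finset.card_product]; linarith [mul_comm A.card Aᶜ.card]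
  · simp [Separates, h]

open Classical in
theorem sum_measureReal_le_integral {Ω ι : Type*} [MeasurableSpace Ω] [Fintype ι] {μ : Measure Ω}
    [IsFiniteMeasure μ] {P : ι → Ω → Prop} (hP : ∀ i, MeasurableSet {ω | P i ω}) {f : Ω → ℝ}
    (hf : Integrable f μ) (h : ∀ ω, ((Finset.univ.filter fun i => P i ω).card : ℝ) ≤ f ω) :
    ∑ i, μ.real {ω | P i ω} ≤ ∫ ω, f ω ∂μ := by
  have hint : ∀ i, Integrable ({ω | P i ω}.indicator (1 : Ω → ℝ)) μ := fun i =>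
    (integrable_const 1).indicator (hP i)
  calc ∑ i, μ.real {ω | P i ω} = ∑ i, ∫ ω, {ω | P i ω}.indicator (1 : Ω → ℝ) ω ∂μ :=
        Finset.sum_congr rfl fun i _ => (integral_indicator_one (hP i)).symm
    _ = ∫ ω, ∑ i, {ω | P i ω}.indicator (1 : Ω → ℝ) ω ∂μ :=
        (integral_finsetSum _ fun i _ => hint i).symm
    _ ≤ _ := by
        refine integral_mono (integrable_finsetSum _ fun i _ => hint i) hf fun ω => ?_
        refine le_trans (le_of_eq ?_) (h ω)
        simp [Set.indicator_apply]

/-! ### Reversing cuts, and the separation bound -/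

variable (G) in
/-- The edges with exactly one end in `U`. -/
def cut (U : Finset V) : Finset G.edgeSet :=
  Finset.univ.filter fun e => bond (fun v => if v ∈ U then -1 else 1) (e : Sym2 V) = -1

theorem hamiltonian_reverseOn_cut (U : Finset V) (J : G.edgeSet → ℝ) (σ : V → ℤˣ) :
    hamiltonian G (reverseOn G (cut G U) J) σ =
      hamiltonian G J ((fun v => if v ∈ U then -1 else 1) * σ) := by
  unfold hamiltonian
  congr 1
  refine Finset.sum_congr rfl fun e _ => ?_
  rw [bond_mul]
  by_cases h : e ∈ cut G U
  · have h' := (Finset.mem_filter.1 h).2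
    simp [reverseOn, h, h']
  · have h' : bond (fun v => if v ∈ U then -1 else 1) (e : Sym2 V) = 1 :=
      (Int.units_eq_one_or _).resolve_right fun h' =>
        h (Finset.mem_filter.2 ⟨Finset.mem_univ _, h'⟩)
    simp [reverseOn, h, h']

/-- Reversing the couplings on the cut of a set that avoids `B` and contains `i` but not `j`
reverses the product of the ground state spins at `i` and `j`. -/
theorem mul_ne_of_reverseOn_cut (hG : G.Connected) (hJ : Generic G J) {U : Finset V}
    (hU : Disjoint U B) {i j : V} (hi : i ∈ U) (hj : j ∉ U) {σ τ : V → ℤˣ}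
    (hσ : IsGroundState G B bc J σ) (hτ : IsGroundState G B bc (reverseOn G (cut G U) J) τ) :
    σ i * σ j ≠ τ i * τ j := by
  set ρ : V → ℤˣ := fun v => if v ∈ U then -1 else 1 with hρ
  have hρB : ∀ k : B, ρ k = 1 := fun k => if_neg (Finset.disjoint_right.1 hU k.2)
  have hρρ : ρ * (ρ * σ) = σ := by
    rw [← mul_assoc]; ext v; simp [Int.units_mul_self]
  have h1 := hσ.2 (ρ * τ) fun k => by simp [hρB k, hτ.1 k]
  have h2 := hτ.2 (ρ * σ) fun k => by simp [hρB k, hσ.1 k]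
  rw [hamiltonian_reverseOn_cut, hamiltonian_reverseOn_cut, ← hρ, hρρ] at h2
  -- `σ` and `ρ * τ` have equal energy under `J`, while `ρ` is `-1` at `i` and `1` at `j`.
  rw [hJ.mul_eq_mul hG (le_antisymm h1 h2) i j]
  simp only [Pi.mul_apply, hρ, hi, hj, if_true, if_false, one_mul, neg_mul]
  exact fun h => absurd h (by
    rcases Int.units_eq_one_or (τ i * τ j) with h | h <;> simp [h])

/-- A union bound over the first change of the product as edges are reversed singly; invariance of
the law returns each event to the original disorder. -/
theorem measure_groundState_mul_ne_le (hG : G.Connected) (B : Finset V) (bc : B → ℤˣ) (i j : V)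
    (g : (G.edgeSet → ℝ) → V → ℤˣ) (hg : ∀ J, IsGroundState G B bc J (g J))
    (S : Finset G.edgeSet) :
    disorder G {J | (∀ T, Generic G (reverseOn G T J)) ∧
        g J i * g J j ≠ g (reverseOn G S J) i * g (reverseOn G S J) j} ≤
      ∑ e ∈ S, disorder G {J | Separates G B bc J e i j} := by
  induction S using Finset.induction_on with
  | empty => simp [reverseOn_empty]
  | insert e S he ih =>
    rw [Finset.sum_insert he, ← (measurePreserving_reverseOn G S).measure_preimage
      (measurableSet_separates B bc e i j).nullMeasurableSet, add_comm]
    refine (measure_mono ?_).trans ((measure_union_le _ _).trans (add_le_add_left ih _))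
    rintro J ⟨hJ, hne⟩
    by_cases h : g J i * g J j = g (reverseOn G S J) i * g (reverseOn G S J) j
    · rw [h, reverseOn_insert G he] at hne
      exact Or.inr (separates_of_mul_ne hG (hJ S) (hg _) (hg _) hne)
    · exact Or.inl ⟨hJ, h⟩

theorem one_le_sum_separates (hG : G.Connected) (bc : B → ℤˣ) {U : Finset V}
    (hU : Disjoint U B) {i j : V} (hi : i ∈ U) (hj : j ∉ U) :
    1 ≤ ∑ e ∈ cut G U, (disorder G).real {J | Separates G B bc J e i j} := by
  choose g hg using exists_isGroundState (G := G) B bc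
  have h := measure_groundState_mul_ne_le hG B bc i j g hg (cut G U)
  have h1 : disorder G {J | (∀ T, Generic G (reverseOn G T J)) ∧ g J i * g J j ≠
      g (reverseOn G (cut G U) J) i * g (reverseOn G (cut G U) J) j} = 1 := by
    rw [← measure_univ (μ := disorder G)]
    refine measure_congr ?_
    filter_upwards [ae_generic_reverseOn G] with J hJ
    refine eq_true ⟨hJ, mul_ne_of_reverseOn_cut hG ?_ hU hi hj (hg _) (hg _)⟩
    simpa [reverseOn_empty] using hJ ∅
  rw [h1] at h
  have := ENNReal.toReal_mono (ENNReal.sum_ne_top.2 fun e _ => measure_ne_top _ _) h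
  rwa [ENNReal.toReal_sum fun e _ => measure_ne_top _ _, ENNReal.toReal_one] at this

/-- The distances from `i` to the two ends of an edge differ by at most 1, so only one integer
radius can fall between them. -/
theorem eq_of_mem_cut_ball (hG : G.Connected) (i : V) {e : G.edgeSet} {r s : ℕ}
    (hr : e ∈ cut G (Finset.univ.filter fun v => G.dist i v ≤ r))
    (hs : e ∈ cut G (Finset.univ.filter fun v => G.dist i v ≤ s)) : r = s := by
  obtain ⟨e, he⟩ := e
  induction e with
  | _ a b =>
    have hab : G.dist a b = 1 := SimpleGraph.dist_eq_one_iff_adj.2 he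
    have h1 := hG.dist_triangle (u := i) (v := a) (w := b)
    have h2 := hG.dist_triangle (u := i) (v := b) (w := a)
    rw [SimpleGraph.dist_comm (u := b), hab] at h2
    rw [hab] at h1
    simp only [cut, Finset.mem_filter, Finset.mem_univ, true_and, bond_eq_neg_one_iff] at hr hs
    split_ifs at hr hs <;> first | omega | exact absurd hr (by decide) | exact absurd hs (by decide)

/-- The probabilities that the critical droplet separates `i` from `j` sum to at least any distance
below which the balls around `i` avoid `j` and `B`. -/
theorem le_sum_separates (hG : G.Connected) (bc : B → ℤˣ) {i j : V} {d : ℕ} (hj : d ≤ G.dist i j)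
    (hB : ∀ k ∈ B, d ≤ G.dist i k) :
    (d : ℝ) ≤ ∑ e, (disorder G).real {J | Separates G B bc J e i j} := by
  have hdisj : Set.PairwiseDisjoint (Finset.range d : Set ℕ)
      (fun r : ℕ => cut G (Finset.univ.filter fun v => G.dist i v ≤ r)) := fun r _ s _ hrs =>
    Finset.disjoint_left.2 fun e hr hs => hrs (eq_of_mem_cut_ball hG i hr hs)
  calc (d : ℝ) = ∑ r ∈ Finset.range d, (1 : ℝ) := by simp
    _ ≤ ∑ r ∈ Finset.range d, ∑ e ∈ cut G (Finset.univ.filter fun v => G.dist i v ≤ r),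
          (disorder G).real {J | Separates G B bc J e i j} := by
        refine Finset.sum_le_sum fun r hr => ?_
        have hr := Finset.mem_range.1 hr
        refine one_le_sum_separates hG bc (Finset.disjoint_left.2 fun v hv hvB => ?_)
          (by simp) (by simp; omega)
        have := hB v hvB
        simp at hv
        omega
    _ = _ := (Finset.sum_biUnion hdisj).symm
    _ ≤ _ := Finset.sum_le_univ_sum_of_nonneg fun e => measureReal_nonneg

theorem sum_le_sum_integral_of_mem (hG : G.Connected) (bc : B → ℤˣ) {k : V} (hk : k ∈ B)
    (d : V → ℕ) (hd : ∀ i, ∀ j ∈ B, d i ≤ G.dist i j) :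
    ∑ i, (d i : ℝ) ≤ ∑ e, ∫ J, (dropletSize G B bc J e : ℝ) ∂(disorder G) := by
  refine (Finset.sum_le_sum fun i _ => le_sum_separates hG bc (hd i k hk) (hd i)).trans ?_
  rw [Finset.sum_comm]
  refine Finset.sum_le_sum fun e _ => ?_
  exact sum_measureReal_le_integral (fun i => measurableSet_separates B bc e i k)
    (integrable_dropletSize B bc e) fun J => by exact_mod_cast card_separates_le_of_mem hk e

theorem sum_dist_le_sum_integral (hG : G.Connected) (hB : B = ∅) (bc : B → ℤˣ) :
    ∑ i, ∑ j, (G.dist i j : ℝ) ≤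
      2 * Fintype.card V * ∑ e, ∫ J, (dropletSize G B bc J e : ℝ) ∂(disorder G) := by
  calc ∑ i, ∑ j, (G.dist i j : ℝ)
      ≤ ∑ i, ∑ j, ∑ e, (disorder G).real {J | Separates G B bc J e i j} :=
        Finset.sum_le_sum fun i _ => Finset.sum_le_sum fun j _ =>
          le_sum_separates hG bc le_rfl (by simp [hB])
    _ = ∑ e, ∑ p : V × V, (disorder G).real {J | Separates G B bc J e p.1 p.2} := by
        rw [Finset.sum_comm (s := Finset.univ (α := G.edgeSet)), Fintype.sum_prod_type]
    _ ≤ ∑ e, ∫ J, 2 * Fintype.card V * (dropletSize G B bc J e : ℝ) ∂(disorder G) := by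
        refine Finset.sum_le_sum fun e _ => ?_
        refine sum_measureReal_le_integral (ι := V × V)
          (P := fun p J => Separates G B bc J e p.1 p.2)
          (fun p => measurableSet_separates B bc e p.1 p.2)
          ((integrable_dropletSize B bc e).const_mul _) fun J => ?_
        have := card_separates_le_of_empty (bc := bc) (J := J) hB e
        exact_mod_cast this
    _ = _ := by simp only [integral_const_mul, Finset.mul_sum]

end EdwardsAnderson

/-! ### From growth bounds to sums of distances -/

namespace EdwardsAnderson

open Classical in
/-- If the sublevel set of `d` at level `((m / 2) / a) ^ (1 / β)` is controlled by the growth bound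
`a * r ^ β`, then the sum of `d` is at least half of `m` times this level. -/
theorem le_sum_of_growth {V : Type u} {s : Finset V} {d : V → ℕ} {a β m : ℝ} (ha : 0 < a)
    (hβ : 0 < β) (hm : 0 ≤ m) (hs : m ≤ s.card) (hpos : m / 2 ≤ ∑ i ∈ s, (d i : ℝ))
    (hgrowth : ∀ r : ℝ, 1 ≤ r → ((s.filter fun i => (d i : ℝ) ≤ r).card : ℝ) ≤ a * r ^ β) :
    m / 2 * (m / (2 * a)) ^ (1 / β) ≤ ∑ i ∈ s, (d i : ℝ) := by
  set r : ℝ := (m / (2 * a)) ^ (1 / β) with hr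
  rcases le_total r 1 with h1 | h1
  -- The growth bound says nothing below radius 1; `hpos` suffices there.
  · exact (mul_le_of_le_one_right (by positivity) h1).trans hpos
  -- The level `r` is chosen so that at least `m / 2` elements have `d` above it.
  · have hrβ : a * r ^ β = m / 2 := by
      rw [hr, ← Real.rpow_mul (by positivity), one_div_mul_cancel hβ.ne', Real.rpow_one]
      field_simp
    have hle := hgrowth r h1
    have hcard : ((s.filter fun i => (d i : ℝ) ≤ r).card : ℝ) +
        ((s.filter fun i => ¬(d i : ℝ) ≤ r).card : ℝ) = s.card := by
      exact_mod_cast Finset.card_filter_add_card_filter_not _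
    calc m / 2 * r ≤ ((s.filter fun i => ¬(d i : ℝ) ≤ r).card : ℝ) * r := by
          gcongr; linarith
      _ = ∑ i ∈ s.filter fun i => ¬(d i : ℝ) ≤ r, r := by simp
      _ ≤ ∑ i ∈ s.filter fun i => ¬(d i : ℝ) ≤ r, (d i : ℝ) :=
          Finset.sum_le_sum fun i hi => (not_le.1 (Finset.mem_filter.1 hi).2).le
      _ ≤ _ := Finset.sum_le_sum_of_subset_of_nonneg (Finset.filter_subset _ _)
          fun i _ _ => Nat.cast_nonneg _

variable {V : Type u} [Fintype V] [DecidableEq V] {G : SimpleGraph V} [DecidableRel G.Adj]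
  {B : Finset V}

theorem le_sum_integral_of_empty (hG : G.Connected) (hB : B = ∅) (bc : B → ℤˣ)
    (hV : 2 ≤ Fintype.card V) {α β : ℝ} (hα : 0 < α) (hβ : 0 < β)
    (hgrowth : ∀ i : V, ∀ r : ℝ, 1 ≤ r →
      (({j : V | (G.dist i j : ℝ) ≤ r}.ncard : ℕ) : ℝ) ≤ α * r ^ β) :
    (Fintype.card V : ℝ) / 4 * (Fintype.card V / (2 * α)) ^ (1 / β) ≤
      ∑ e, ∫ J, (dropletSize G B bc J e : ℝ) ∂(disorder G) := by
  classical
  have hn : (2 : ℝ) ≤ Fintype.card V := by exact_mod_cast hV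
  have key : ∀ i : V, (Fintype.card V : ℝ) / 2 * (Fintype.card V / (2 * α)) ^ (1 / β) ≤
      ∑ j, (G.dist i j : ℝ) := by
    intro i
    refine le_sum_of_growth hα hβ (by positivity) (by simp) ?_ fun r hr => ?_
    · calc (Fintype.card V : ℝ) / 2 ≤ Fintype.card V - 1 := by linarith
        _ = ∑ j ∈ Finset.univ.erase i, (1 : ℝ) := by
            simp [Finset.card_erase_of_mem, Nat.cast_sub (by omega : 1 ≤ Fintype.card V)]
        _ ≤ ∑ j ∈ Finset.univ.erase i, (G.dist i j : ℝ) := Finset.sum_le_sum fun j hj => by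
            exact_mod_cast hG.pos_dist_of_ne (Finset.ne_of_mem_erase hj).symm
        _ ≤ _ := Finset.sum_le_univ_sum_of_nonneg fun j => Nat.cast_nonneg _
    · refine le_trans (le_of_eq ?_) (hgrowth i r hr)
      rw [← Set.ncard_coe_finset]
      congr 2
      ext j
      simp
  have h := (Finset.sum_le_sum fun i (_ : i ∈ Finset.univ) => key i).trans
    (sum_dist_le_sum_integral hG hB bc)
  rw [Finset.sum_const, nsmul_eq_mul, Finset.card_univ, mul_comm (2 : ℝ) (Fintype.card V),
    mul_assoc] at h
  have := le_of_mul_le_mul_left h (by linarith)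
  linarith

theorem le_sum_integral_of_nonempty (hG : G.Connected) (hB : B.Nonempty) (bc : B → ℤˣ)
    {γ δ : ℝ} (hγ : 0 < γ) (hδ : 0 < δ)
    (hgrowth : ∀ r : ℝ, 1 ≤ r →
      (({j : V | ∃ k ∈ B, (G.dist j k : ℝ) ≤ r}.ncard : ℕ) : ℝ) ≤ γ * (B.card : ℝ) * r ^ δ) :
    (Bᶜ.card : ℝ) / 2 * (Bᶜ.card / (2 * (γ * B.card))) ^ (1 / δ) ≤
      ∑ e, ∫ J, (dropletSize G B bc J e : ℝ) ∂(disorder G) := by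
  classical
  obtain ⟨k, hk⟩ := hB
  have hb : (0 : ℝ) < B.card := by exact_mod_cast Finset.card_pos.2 ⟨k, hk⟩
  -- The distance to `B`: balls of smaller radius avoid `B`, and with it `k`.
  set d : V → ℕ := fun i => B.inf' ⟨k, hk⟩ (G.dist i) with hd
  refine le_trans ?_ ((Finset.sum_le_univ_sum_of_nonneg (s := Bᶜ) fun i => Nat.cast_nonneg _).trans
    (sum_le_sum_integral_of_mem hG bc hk d fun i j hj => Finset.inf'_le _ hj))
  refine le_sum_of_growth (s := Bᶜ) (mul_pos hγ hb) hδ (by positivity) le_rfl ?_ fun r hr => ?_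
  · calc (Bᶜ.card : ℝ) / 2 ≤ ∑ i ∈ Bᶜ, (1 : ℝ) := by simp
      _ ≤ _ := Finset.sum_le_sum fun i hi => by
          have : 1 ≤ d i := Finset.le_inf' _ _ fun j hj => hG.pos_dist_of_ne fun hij =>
            Finset.mem_compl.1 hi (hij ▸ hj)
          exact_mod_cast this
  · refine le_trans ?_ (hgrowth r hr)
    rw [← Set.ncard_coe_finset]
    refine Nat.cast_le.2 (Set.ncard_le_ncard (fun i hi => ?_) (Set.toFinite _))
    obtain ⟨j, hj, hij⟩ := Finset.exists_mem_eq_inf' ⟨k, hk⟩ (G.dist i)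
    have hi := (Finset.mem_filter.1 (Finset.mem_coe.1 hi)).2
    exact ⟨j, hj, by simpa only [hd, hij] using hi⟩

end EdwardsAnderson

/-! ### The main theorem -/

theorem mainTheorem6 (α β γ δ : ℝ) (hα : 0 < α) (hβ : 0 < β) (hγ : 0 < γ) (hδ : 0 < δ) :
    ∃ C : ℝ, 0 < C ∧
      ∀ (V : Type u) [Fintype V] [DecidableEq V] (G : SimpleGraph V) [DecidableRel G.Adj]
        (B : Finset V) (bc : B → ℤˣ),
        G.Connected →
        (G.induce {v : V | v ∉ B}).Connected →
        2 ≤ Fintype.card G.edgeSet →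
        (∀ i : V, i ∉ B → ∀ r : ℝ, 1 ≤ r →
          (({j : V | (G.dist i j : ℝ) ≤ r}.ncard : ℕ) : ℝ) ≤ α * r ^ β) →
        (∀ r : ℝ, 1 ≤ r →
          (({j : V | ∃ k ∈ B, (G.dist j k : ℝ) ≤ r}.ncard : ℕ) : ℝ) ≤ γ * (B.card : ℝ) * r ^ δ) →
        (∀ e : G.edgeSet,
          Integrable (fun J => (EdwardsAnderson.dropletSize G B bc J e : ℝ))
            (EdwardsAnderson.disorder G)) ∧
        (1 / (Fintype.card G.edgeSet : ℝ)) *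
            ∑ e : G.edgeSet,
              ∫ J, (EdwardsAnderson.dropletSize G B bc J e : ℝ) ∂(EdwardsAnderson.disorder G) ≥
          C * ((Bᶜ).card : ℝ) /
            ((Fintype.card G.edgeSet : ℝ) *
              max (((Bᶜ).card : ℝ) ^ (-(1 / β)))
                (((B.card : ℝ) / ((Bᶜ).card : ℝ)) ^ (1 / δ))) := by
  -- The two constants come from the free case and the case of nonempty `B`; each case bounds the
  -- maximum below by its own term.
  have hC1 : 0 < (1 / (2 * α)) ^ (1 / β) / 4 := by positivity
  have hC2 : 0 < (1 / (2 * γ)) ^ (1 / δ) / 2 := by positivity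
  refine ⟨_, lt_min hC1 hC2, fun V _ _ G _ B bc hG hind hE hball hcollar =>
    ⟨EdwardsAnderson.integrable_dropletSize B bc, ?_⟩⟩
  set C := min ((1 / (2 * α)) ^ (1 / β) / 4) ((1 / (2 * γ)) ^ (1 / δ) / 2)
  have hE0 : (0 : ℝ) < Fintype.card G.edgeSet := by exact_mod_cast (by omega)
  have hm : (0 : ℝ) < Bᶜ.card := by
    obtain ⟨v, hv⟩ := hind.nonempty
    exact_mod_cast Finset.card_pos.2 ⟨v, Finset.mem_compl.2 hv⟩
  have hmax := lt_max_of_lt_left (c := ((B.card : ℝ) / Bᶜ.card) ^ (1 / δ))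
    (Real.rpow_pos_of_pos hm (-(1 / β)))
  rw [ge_iff_le, mul_comm (Fintype.card G.edgeSet : ℝ), ← div_div, one_div_mul_eq_div]
  refine div_le_div_of_nonneg_right ?_ hE0.le
  rcases B.eq_empty_or_nonempty with hB | hB
  · have hcard : (Bᶜ.card : ℝ) = Fintype.card V := by simp [hB]
    have hV : 2 ≤ Fintype.card V := by
      by_contra! h
      have : Subsingleton V := Fintype.card_le_one_iff_subsingleton.1 (by omega)
      obtain ⟨⟨e, he⟩⟩ : Nonempty G.edgeSet := Fintype.card_pos_iff.1 (by omega)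
      induction e with
      | _ a b => exact G.ne_of_adj he (Subsingleton.elim a b)
    refine le_trans ?_ (EdwardsAnderson.le_sum_integral_of_empty hG hB bc hV hα hβ
      fun i => hball i (by simp [hB]))
    rw [hcard] at hm hmax ⊢
    calc C * (Fintype.card V : ℝ) / _
        ≤ (1 / (2 * α)) ^ (1 / β) / 4 * Fintype.card V / (Fintype.card V : ℝ) ^ (-(1 / β)) :=
          div_le_div₀ (by positivity) (by gcongr; exact min_le_left _ _) (by positivity)
            (le_max_left _ _)
      _ = _ := by
          rw [Real.rpow_neg hm.le, div_inv_eq_mul, div_eq_mul_one_div (Fintype.card V : ℝ) (2 * α),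
            Real.mul_rpow hm.le (by positivity)]
          ring
  · have hb : (0 : ℝ) < B.card := by exact_mod_cast Finset.card_pos.2 hB
    refine le_trans ?_ (EdwardsAnderson.le_sum_integral_of_nonempty hG hB bc hγ hδ hcollar)
    calc C * (Bᶜ.card : ℝ) / _
        ≤ (1 / (2 * γ)) ^ (1 / δ) / 2 * Bᶜ.card / ((B.card : ℝ) / Bᶜ.card) ^ (1 / δ) :=
          div_le_div₀ (by positivity) (by gcongr; exact min_le_right _ _) (by positivity)
            (le_max_right _ _)
      _ = _ := by
          have : (Bᶜ.card : ℝ) / (2 * (γ * B.card)) =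
              1 / (2 * γ) / ((B.card : ℝ) / Bᶜ.card) := by field_simp
          rw [this, Real.div_rpow (x := 1 / (2 * γ)) (by positivity) (by positivity)]
          ring
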